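/- Let $n\ge 2$, let $\Omega\subset\mathbb R^n$ be a bounded domain with Lipschitz boundary, let $0<T<\infty$ and $Q=\Omega\times(0,T)$, with points $z=(x,t)$. Let $p$ be continuous on $\overline Q$ with minimum $p^->1$ and maximum $p^+$, and let $\omega$ be a modulus of continuity of $p$, i.e. $|p(z_1)-p(z_2)|\le\omega(|z_1-z_2|)$ for all $z_1,z_2\in\overline Q$ and $\omega(\tau)\to0$ as $\tau\to0^+$. Denote by $\nabla$ the gradient in $x$. Let $u\in L^\infty(0,T;L^2(\Omega))\cap \mathbf W_{p(\cdot)}(Q)$, where $u\in\mathbf W_{p(\cdot)}(Q)$ means that $u\in L^2(Q)$, $|\nabla u|^{p(z)}\in L^1(Q)$, and for a.e. $t\in(0,T)$ one has $u(\cdot,t)\in L^2(\Omega)\cap W^{1,1}_0(\Omega)$ and $|\nabla u(\cdot,t)|^{p(\cdot,t)}\in L^1(\Omega)$. Suppose that $$\operatorname*{ess\,sup}_{t\in(0,T)}\|u(\cdot,t)\|_{L^2(\Omega)}^2+\int_Q|\nabla u|^{p(z)}\,dz\le M .$$ Then for every $\epsilon\in(0,\frac1n)$ one has $u\in L^{p(\cdot)+\epsilon}(Q)$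 and $$\|u\|_{L^{p(\cdot)+\epsilon}(Q)}\le C,$$ where $\|u\|_{L^{q(\cdot)}(Q)}=\inf\{\lambda>0:\int_Q|u/\lambda|^{q(z)}\,dz\le1\}$ is the Luxemburg norm and the constant $C$ depends only on $M$, $p^-$, $p^+$, $n$, $\omega$, $|\Omega|$, $\epsilon$ and the (fixed) height $T$ of the cylinder. -/

import Mathlib

open Set Filter Topology MeasureTheory
open scoped ENNReal NNReal

/-- The boundary of `Ω` is Lipschitz: near each boundary point `x₀` there are a direction `e` (the
local vertical axis) and a Lipschitz function `γ` of the component `y - ⟪e, y⟫ e` orthogonal to `e`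
such that, in a ball around `x₀`, the set `Ω` is the part lying strictly above the graph of `γ`. -/
def HasLipschitzBoundary {n : ℕ} (Ω : Set (EuclideanSpace ℝ (Fin n))) : Prop :=
  ∀ x₀ ∈ frontier Ω, ∃ r > (0 : ℝ), ∃ e : EuclideanSpace ℝ (Fin n), ‖e‖ = 1 ∧
    ∃ (L : ℝ≥0) (γ : EuclideanSpace ℝ (Fin n) → ℝ), LipschitzWith L γ ∧
      ∀ y ∈ Metric.ball x₀ r, (y ∈ Ω ↔ γ (y - (inner ℝ e y : ℝ) • e) < (inner ℝ e y : ℝ))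

/-- A bounded domain (nonempty connected open set) of `ℝⁿ` with Lipschitz boundary. -/
structure IsBoundedLipschitzDomain {n : ℕ} (Ω : Set (EuclideanSpace ℝ (Fin n))) : Prop where
  isOpen : IsOpen Ω
  isConnected : IsConnected Ω
  isBounded : Bornology.IsBounded Ω
  lipschitz : HasLipschitzBoundary Ω

/-- The space-time cylinder `Q = Ω × (0, T)`; its points are `z = (x, t)`. -/
def spaceTimeCylinder {n : ℕ} (Ω : Set (EuclideanSpace ℝ (Fin n))) (T : ℝ) :
    Set (EuclideanSpace ℝ (Fin n) × ℝ) :=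
  Ω ×ˢ Ioo (0 : ℝ) T

/-- Smooth functions with compact support contained in `Ω`, that is `C₀^∞(Ω)`. -/
structure IsTestFunction {n : ℕ} (Ω : Set (EuclideanSpace ℝ (Fin n)))
    (φ : EuclideanSpace ℝ (Fin n) → ℝ) : Prop where
  smooth : ContDiff ℝ ((⊤ : ℕ∞) : WithTop ℕ∞) φ
  compact : HasCompactSupport φ
  support : tsupport φ ⊆ Ω

/-- `G` is the weak (distributional) gradient of `f` in `Ω`. -/
def HasWeakGradient {n : ℕ} (Ω : Set (EuclideanSpace ℝ (Fin n)))
    (f : EuclideanSpace ℝ (Fin n) → ℝ)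
    (G : EuclideanSpace ℝ (Fin n) → EuclideanSpace ℝ (Fin n)) : Prop :=
  LocallyIntegrableOn f Ω ∧ LocallyIntegrableOn G Ω ∧
    ∀ φ, IsTestFunction Ω φ →
      ∫ x in Ω, f x • gradient φ x = - ∫ x in Ω, φ x • G x

/-- `f ∈ W₀^{1,1}(Ω)` with weak gradient `∇f = G`: both are integrable on `Ω`, and `f` is a limit of
test functions in the norm of `W^{1,1}(Ω)`. -/
structure MemW₀11 {n : ℕ} (Ω : Set (EuclideanSpace ℝ (Fin n)))
    (f : EuclideanSpace ℝ (Fin n) → ℝ)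
    (G : EuclideanSpace ℝ (Fin n) → EuclideanSpace ℝ (Fin n)) : Prop where
  integrable : IntegrableOn f Ω
  integrable_grad : IntegrableOn G Ω
  weakGradient : HasWeakGradient Ω f G
  approx : ∃ φ : ℕ → EuclideanSpace ℝ (Fin n) → ℝ, (∀ k, IsTestFunction Ω (φ k)) ∧
    Tendsto (fun k => eLpNorm (fun x => φ k x - f x) 1 (volume.restrict Ω)) atTop (𝓝 0) ∧
    Tendsto (fun k => eLpNorm (fun x => gradient (φ k) x - G x) 1 (volume.restrict Ω))
      atTop (𝓝 0)

/-- The modular `∫_S |f|^{q(z)} dz`, with value in `[0, ∞]`. -/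
noncomputable def varModular {α F : Type*} [MeasureSpace α] [NormedAddCommGroup F]
    (S : Set α) (q : α → ℝ) (f : α → F) : ℝ≥0∞ :=
  ∫⁻ z in S, ENNReal.ofReal (‖f z‖ ^ q z)

/-- The variable exponent Lebesgue space `L^{q(·)}(S)`. -/
def MemVarLp {α F : Type*} [MeasureSpace α] [NormedAddCommGroup F]
    (S : Set α) (q : α → ℝ) (f : α → F) : Prop :=
  AEStronglyMeasurable f (volume.restrict S) ∧ varModular S q f < ∞

/-- The Luxemburg norm `inf {a > 0 : ∫_S |f / a|^{q(z)} dz ≤ 1}`, with value `∞` if there is no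
such `a`. -/
noncomputable def luxemburgNorm {α F : Type*} [MeasureSpace α] [NormedAddCommGroup F]
    [NormedSpace ℝ F] (S : Set α) (q : α → ℝ) (f : α → F) : ℝ≥0∞ :=
  ⨅ (a : ℝ≥0) (_ : 0 < a ∧ varModular S q (fun z => (a : ℝ)⁻¹ • f z) ≤ 1), (a : ℝ≥0∞)

/-- `f ∈ V_t(Ω)`, with weak gradient `∇f = G`, for the exponent `q = p(·, t)`:
`f ∈ L²(Ω) ∩ W₀^{1,1}(Ω)` and `|∇f|^{q(x)} ∈ L¹(Ω)`. -/
structure MemV {n : ℕ} (Ω : Set (EuclideanSpace ℝ (Fin n)))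
    (q : EuclideanSpace ℝ (Fin n) → ℝ) (f : EuclideanSpace ℝ (Fin n) → ℝ)
    (G : EuclideanSpace ℝ (Fin n) → EuclideanSpace ℝ (Fin n)) : Prop where
  memL2 : MemLp f 2 (volume.restrict Ω)
  memW₀11 : MemW₀11 Ω f G
  grad : MemVarLp Ω q G

/-- `u ∈ W_{p(·)}(Q)` with spatial gradient `∇u = g`: for almost every `t ∈ (0, T)` the slice
`u(·, t)` lies in `V_t(Ω)` and `g(·, t)` is its weak gradient, `u ∈ L²(Q)`, and
`|∇u|^{p(z)} ∈ L¹(Q)`. -/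
structure MemParabolicW {n : ℕ} (Ω : Set (EuclideanSpace ℝ (Fin n))) (T : ℝ)
    (p : EuclideanSpace ℝ (Fin n) × ℝ → ℝ) (u : EuclideanSpace ℝ (Fin n) × ℝ → ℝ)
    (g : EuclideanSpace ℝ (Fin n) × ℝ → EuclideanSpace ℝ (Fin n)) : Prop where
  slice : ∀ᵐ t ∂(volume.restrict (Ioo (0 : ℝ) T)),
    MemV Ω (fun x => p (x, t)) (fun x => u (x, t)) (fun x => g (x, t))
  memL2 : MemLp u 2 (volume.restrict (spaceTimeCylinder Ω T))
  grad : MemVarLp (spaceTimeCylinder Ω T) p g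

/-- `ess sup_{t ∈ (0, T)} ‖u(·, t)‖²_{L²(Ω)}`, with value in `[0, ∞]`. -/
noncomputable def essSupL2Sq {n : ℕ} (Ω : Set (EuclideanSpace ℝ (Fin n))) (T : ℝ)
    (u : EuclideanSpace ℝ (Fin n) × ℝ → ℝ) : ℝ≥0∞ :=
  essSup (fun t => eLpNorm (fun x => u (x, t)) 2 (volume.restrict Ω) ^ 2)
    (volume.restrict (Ioo (0 : ℝ) T))

/-- `u ∈ L^∞(0, T; L²(Ω))`. -/
def MemLinftyL2 {n : ℕ} (Ω : Set (EuclideanSpace ℝ (Fin n))) (T : ℝ)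
    (u : EuclideanSpace ℝ (Fin n) × ℝ → ℝ) : Prop :=
  AEStronglyMeasurable u (volume.restrict (spaceTimeCylinder Ω T)) ∧ essSupL2Sq Ω T u < ∞

/-- `ω` is a modulus of continuity of `p` on `S ⊆ ℝⁿ × ℝ`: `ω(τ) → 0` as `τ → 0⁺`, and
`|p(z₁) - p(z₂)| ≤ ω(|z₁ - z₂|)`, where `|z₁ - z₂|` is the Euclidean distance of `ℝⁿ⁺¹`. -/
def IsModulusOfContinuityOn {n : ℕ} (ω : ℝ → ℝ) (p : EuclideanSpace ℝ (Fin n) × ℝ → ℝ)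
    (S : Set (EuclideanSpace ℝ (Fin n) × ℝ)) : Prop :=
  Tendsto ω (𝓝[>] 0) (𝓝 0) ∧
    ∀ z₁ ∈ S, ∀ z₂ ∈ S,
      |p z₁ - p z₂| ≤ ω (Real.sqrt (‖z₁.1 - z₂.1‖ ^ 2 + (z₁.2 - z₂.2) ^ 2))

/-! The estimate is proved on almost every time slice with a constant independent of `t`, then
integrated over `(0, T)`.

On a slice write `f`, `G` for the function and its gradient. The modulus `ω` yields a `C¹` exponent
`r` with `p - 1/n ≤ r ≤ p` and `|∇r| ≤ L`, where `L` depends only on `ω`, `n` and the bounds of `p`.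
With `h(s)` close to `√(1 + s²)`, the function `h(f)^r - 1` vanishes where `f` does, so the Sobolev
inequality `W₀^{1,1} ⊆ L^{n/(n-1)}` bounds it by the integral of `r h^{r-1} |G| + L h^r log h`.
Hölder's inequality with exponents `n` and `n/(n-1)`, together with the `L²` bound on `f`, then
controls `∫ h^{r+2/n}` by the same integral.

Young's inequality bounds the integrand by `η h^{r+2/n} + C (1 + |G|^p)`, the logarithm being
dominated by the extra power `2/n`. For small `η` the first term is absorbed into the left-hand
side. Absorption needs finiteness, so `h` is truncated first, and Fatou's lemma removes the
truncation (`exists_lintegral_rpow_le`). Finally `p + ε ≤ p + 1/n ≤ r + 2/n`. Only `x`-derivatives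
of `r` occur, so each slice may choose its own `r`, with no regularity in `t`. -/

/-- A smooth, possibly truncated substitute for `1 + |s|`: a `C¹` function that is at least `1`,
equals `1` at the origin and has slope at most `1`. -/
structure IsSmoothHeight (h : ℝ → ℝ) : Prop where
  contDiff : ContDiff ℝ 1 h
  map_zero : h 0 = 1
  one_le : ∀ s, 1 ≤ h s
  abs_deriv_le : ∀ s, |deriv h s| ≤ 1

theorem IsSmoothHeight.pos {h : ℝ → ℝ} (hh : IsSmoothHeight h) (s : ℝ) : 0 < h s :=
  zero_lt_one.trans_le (hh.one_le s)

/-! ### Differentiating a power with variable exponent -/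

section Composition

variable {E : Type*} [NormedAddCommGroup E] [NormedSpace ℝ E] {h : ℝ → ℝ} {φ r : E → ℝ}

theorem IsSmoothHeight.hasFDerivAt_rpow (hh : IsSmoothHeight h) {x : E}
    (hφ : DifferentiableAt ℝ φ x) (hr : DifferentiableAt ℝ r x) :
    HasFDerivAt (fun y => h (φ y) ^ r y - 1)
      ((r x * h (φ x) ^ (r x - 1)) • (deriv h (φ x) • fderiv ℝ φ x) +
        (h (φ x) ^ r x * Real.log (h (φ x))) • fderiv ℝ r x) x := by
  have h1 : HasDerivAt h (deriv h (φ x)) (φ x) :=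
    (hh.contDiff.differentiable one_ne_zero _).hasDerivAt
  have h2 : HasFDerivAt (fun y => h (φ y)) (deriv h (φ x) • fderiv ℝ φ x) x :=
    h1.comp_hasFDerivAt x hφ.hasFDerivAt
  exact (h2.rpow hr.hasFDerivAt (hh.pos _)).sub_const 1

theorem IsSmoothHeight.contDiff_rpow (hh : IsSmoothHeight h) (hφ : ContDiff ℝ 1 φ)
    (hr : ContDiff ℝ 1 r) : ContDiff ℝ 1 (fun y => h (φ y) ^ r y - 1) :=
  ((hh.contDiff.comp hφ).rpow hr fun _ => (hh.pos _).ne').sub contDiff_const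

theorem IsSmoothHeight.norm_fderiv_rpow_le (hh : IsSmoothHeight h) {x : E}
    (hφ : DifferentiableAt ℝ φ x) (hr : DifferentiableAt ℝ r x) {L R : ℝ}
    (hL : ‖fderiv ℝ r x‖ ≤ L) (hr0 : 0 ≤ r x) (hrR : r x ≤ R) :
    ‖fderiv ℝ (fun y => h (φ y) ^ r y - 1) x‖ ≤
      R * h (φ x) ^ (r x - 1) * ‖fderiv ℝ φ x‖ + L * (h (φ x) ^ r x * Real.log (h (φ x))) := by
  rw [(hh.hasFDerivAt_rpow hφ hr).fderiv]
  have hp := hh.pos (φ x)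
  have hlog : 0 ≤ Real.log (h (φ x)) := Real.log_nonneg (hh.one_le _)
  have e1 : 0 ≤ h (φ x) ^ (r x - 1) := by positivity
  have e2 : 0 ≤ h (φ x) ^ r x * Real.log (h (φ x)) := by positivity
  refine (norm_add_le _ _).trans (add_le_add ?_ ?_)
  · rw [norm_smul, norm_smul, Real.norm_of_nonneg (by positivity), Real.norm_eq_abs]
    have hR : 0 ≤ R := hr0.trans hrR
    have : |deriv h (φ x)| * ‖fderiv ℝ φ x‖ ≤ ‖fderiv ℝ φ x‖ :=
      mul_le_of_le_one_left (norm_nonneg _) (hh.abs_deriv_le _)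
    gcongr
  · rw [norm_smul, Real.norm_of_nonneg e2, mul_comm]
    gcongr

end Composition

/-! ### The Sobolev inequality for variable powers -/

variable {n : ℕ}

theorem enorm_gradient (φ : EuclideanSpace ℝ (Fin n) → ℝ) (x : EuclideanSpace ℝ (Fin n)) :
    ‖gradient φ x‖ₑ = ‖fderiv ℝ φ x‖ₑ := by
  simp only [gradient, enorm_eq_nnnorm]
  congr 1
  exact (InnerProductSpace.toDual ℝ (EuclideanSpace ℝ (Fin n))).symm.nnnorm_map _

/-- The density of the total variation of `h(f)^r`, for a function `f` with gradient `G`. -/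
noncomputable def rpowVariation (h : ℝ → ℝ) (r : EuclideanSpace ℝ (Fin n) → ℝ) (L R : ℝ)
    (f : EuclideanSpace ℝ (Fin n) → ℝ) (G : EuclideanSpace ℝ (Fin n) → EuclideanSpace ℝ (Fin n))
    (x : EuclideanSpace ℝ (Fin n)) : ℝ≥0∞ :=
  ENNReal.ofReal (R * h (f x) ^ (r x - 1)) * ‖G x‖ₑ +
    ENNReal.ofReal (L * (h (f x) ^ r x * Real.log (h (f x))))

/-- The constant of the Sobolev inequality `W₀^{1,1} ⊆ L^{n/(n-1)}` of `ℝⁿ`. -/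
noncomputable def sobolevConst (n : ℕ) : ℝ≥0 :=
  eLpNormLESNormFDerivOneConst (volume : Measure (EuclideanSpace ℝ (Fin n)))
    (NNReal.conjExponent n : ℝ≥0)

/-- Since `h 0 = 1`, subtracting `1` gives a function supported where `φ` is, hence compactly
supported in `Ω`. The Sobolev inequality of the whole space therefore applies whatever `r` does
outside `Ω`. -/
theorem eLpNorm_rpow_sub_one_le_of_isTestFunction (hn : 2 ≤ n)
    {Ω : Set (EuclideanSpace ℝ (Fin n))} (hΩ : MeasurableSet Ω)
    {φ r : EuclideanSpace ℝ (Fin n) → ℝ} (hφ : IsTestFunction Ω φ)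
    {h : ℝ → ℝ} (hh : IsSmoothHeight h) (hr : ContDiff ℝ 1 r)
    {L R : ℝ} (hL : ∀ x, ‖fderiv ℝ r x‖ ≤ L) (hr0 : ∀ x ∈ Ω, 0 ≤ r x) (hrR : ∀ x ∈ Ω, r x ≤ R) :
    eLpNorm (fun x => h (φ x) ^ r x - 1) (NNReal.conjExponent n : ℝ≥0) (volume.restrict Ω) ≤
      sobolevConst n * ∫⁻ x in Ω, rpowVariation h r L R φ (gradient φ) x := by
  have hφ1 : ContDiff ℝ 1 φ := hφ.smooth.of_le (by exact_mod_cast le_top)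
  set w := fun x => h (φ x) ^ r x - 1 with hw
  have hw0 : ∀ x, φ x = 0 → w x = 0 := fun x hx => by simp [hw, hx, hh.map_zero]
  have hsub : Function.support w ⊆ Function.support φ := fun x hx hx' => hx (hw0 x hx')
  have hwc : HasCompactSupport w := hφ.compact.mono hsub
  have hts : tsupport w ⊆ Ω := (closure_mono hsub).trans hφ.support
  have key := eLpNorm_le_eLpNorm_fderiv_one (volume : Measure (EuclideanSpace ℝ (Fin n)))
    (hh.contDiff_rpow hφ1 hr) hwc (p := NNReal.conjExponent n) (by
      rw [finrank_euclideanSpace_fin]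
      exact .conjExponent (by exact_mod_cast hn))
  refine (eLpNorm_mono_measure _ Measure.restrict_le_self).trans (key.trans ?_)
  rw [eLpNorm_one_eq_lintegral_enorm]
  refine mul_le_mul' le_rfl ?_
  rw [← setLIntegral_eq_of_support_subset (s := Ω)]
  · refine setLIntegral_mono' hΩ fun x hx => ?_
    have := hh.norm_fderiv_rpow_le (hφ1.differentiable one_ne_zero x)
      (hr.differentiable one_ne_zero x) (hL x) (hr0 x hx) (hrR x hx)
    have hp := hh.pos (φ x)
    have hR : 0 ≤ R := (hr0 x hx).trans (hrR x hx)
    have hL0 : 0 ≤ L := (norm_nonneg _).trans (hL x)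
    have hlog : 0 ≤ Real.log (h (φ x)) := Real.log_nonneg (hh.one_le _)
    rw [← ofReal_norm]
    refine (ENNReal.ofReal_le_ofReal this).trans ?_
    rw [ENNReal.ofReal_add (by positivity) (by positivity), ENNReal.ofReal_mul (by positivity),
      ofReal_norm, rpowVariation, enorm_gradient]
  · intro x hx
    refine hts (support_fderiv_subset ℝ fun h0 => hx ?_)
    change ‖fderiv ℝ w x‖ₑ = 0
    rw [← ofReal_norm, h0, norm_zero, ENNReal.ofReal_zero]

theorem aemeasurable_rpowVariation {h : ℝ → ℝ} (hh : IsSmoothHeight h)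
    {Ω : Set (EuclideanSpace ℝ (Fin n))} {f r : EuclideanSpace ℝ (Fin n) → ℝ}
    {G : EuclideanSpace ℝ (Fin n) → EuclideanSpace ℝ (Fin n)}
    (hf : AEMeasurable f (volume.restrict Ω)) (hG : AEMeasurable G (volume.restrict Ω))
    (hr : Continuous r) (L R : ℝ) :
    AEMeasurable (rpowVariation h r L R f G) (volume.restrict Ω) := by
  have h1 := hh.contDiff.continuous.measurable.comp_aemeasurable hf
  have h2 := hr.measurable.aemeasurable (μ := volume.restrict Ω)
  have h3 := (h1.pow h2)
  have h4 := (h1.pow (h2.sub_const 1))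
  have h5 := Real.measurable_log.comp_aemeasurable h1
  exact ((h4.const_mul R).ennreal_ofReal.mul hG.enorm).add
    ((h3.mul h5).const_mul L).ennreal_ofReal

theorem Real.rpow_le_rpow_of_one_le_of_le {y s K R : ℝ} (hy : 1 ≤ y) (hyK : y ≤ K)
    (hs : s ≤ R) (hR : 0 ≤ R) :
    y ^ s ≤ K ^ R :=
  (Real.rpow_le_rpow_of_exponent_le hy hs).trans
    (Real.rpow_le_rpow (zero_le_one.trans hy) hyK hR)

theorem rpowVariation_le {h : ℝ → ℝ} (hh : IsSmoothHeight h) {K : ℝ} (hK : ∀ s, h s ≤ K)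
    {r f : EuclideanSpace ℝ (Fin n) → ℝ} {L R : ℝ} (hL : 0 ≤ L) (hR : 0 ≤ R)
    {x : EuclideanSpace ℝ (Fin n)} (hrR : r x ≤ R)
    (G : EuclideanSpace ℝ (Fin n) → EuclideanSpace ℝ (Fin n)) :
    rpowVariation h r L R f G x ≤ ENNReal.ofReal (R * K ^ R) * ‖G x‖ₑ +
      ENNReal.ofReal (L * (K ^ R * Real.log K)) := by
  have h1 := hh.one_le (f x)
  have hp := hh.pos (f x)
  have e1 := Real.rpow_le_rpow_of_one_le_of_le h1 (hK _)
    (sub_le_self_iff _ |>.2 zero_le_one |>.trans hrR) hR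
  have e2 := Real.rpow_le_rpow_of_one_le_of_le h1 (hK _) hrR hR
  have e3 := Real.log_le_log hp (hK (f x))
  have e4 : 0 ≤ Real.log (h (f x)) := Real.log_nonneg h1
  have e5 : 0 ≤ K := hp.le.trans (hK _)
  unfold rpowVariation
  gcongr

theorem rpowVariation_le_add {h : ℝ → ℝ} (hh : IsSmoothHeight h) {K : ℝ} (hK : ∀ s, h s ≤ K)
    {r f : EuclideanSpace ℝ (Fin n) → ℝ} {L R : ℝ} (hR : 0 ≤ R)
    {x : EuclideanSpace ℝ (Fin n)} (hrR : r x ≤ R)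
    (G H : EuclideanSpace ℝ (Fin n) → EuclideanSpace ℝ (Fin n)) :
    rpowVariation h r L R f H x ≤ rpowVariation h r L R f G x +
      ENNReal.ofReal (R * K ^ R) * ‖H x - G x‖ₑ := by
  have h1 := hh.one_le (f x)
  have e1 := Real.rpow_le_rpow_of_one_le_of_le h1 (hK _)
    (sub_le_self_iff _ |>.2 zero_le_one |>.trans hrR) hR
  have e2 : ‖H x‖ₑ ≤ ‖G x‖ₑ + ‖H x - G x‖ₑ := by
    simpa using enorm_add_le (G x) (H x - G x)
  unfold rpowVariation
  calc _ ≤ ENNReal.ofReal (R * h (f x) ^ (r x - 1)) * (‖G x‖ₑ + ‖H x - G x‖ₑ) +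
        ENNReal.ofReal (L * (h (f x) ^ r x * Real.log (h (f x)))) := by gcongr
    _ = ENNReal.ofReal (R * h (f x) ^ (r x - 1)) * ‖G x‖ₑ +
        ENNReal.ofReal (L * (h (f x) ^ r x * Real.log (h (f x)))) +
        ENNReal.ofReal (R * h (f x) ^ (r x - 1)) * ‖H x - G x‖ₑ := by ring
    _ ≤ _ := by gcongr

/-- Density of test functions. Along an a.e. convergent subsequence, Fatou's lemma handles the
left-hand side. On the right, the gradients are first replaced by `G`, at a cost that tends to zero
because the bound `K` makes the coefficients bounded; dominated convergence does the rest. -/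
theorem MemW₀11.eLpNorm_rpow_sub_one_le (hn : 2 ≤ n)
    {Ω : Set (EuclideanSpace ℝ (Fin n))} (hΩ : MeasurableSet Ω) (hΩfin : volume Ω ≠ ∞)
    {f : EuclideanSpace ℝ (Fin n) → ℝ} {G : EuclideanSpace ℝ (Fin n) → EuclideanSpace ℝ (Fin n)}
    (hf : MemW₀11 Ω f G) {r : EuclideanSpace ℝ (Fin n) → ℝ}
    {h : ℝ → ℝ} (hh : IsSmoothHeight h) {K : ℝ} (hK : ∀ s, h s ≤ K) (hr : ContDiff ℝ 1 r)
    {L R : ℝ} (hL : ∀ x, ‖fderiv ℝ r x‖ ≤ L) (hR : 0 ≤ R) (hr0 : ∀ x ∈ Ω, 0 ≤ r x)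
    (hrR : ∀ x ∈ Ω, r x ≤ R) :
    eLpNorm (fun x => h (f x) ^ r x - 1) (NNReal.conjExponent n : ℝ≥0) (volume.restrict Ω) ≤
      sobolevConst n * ∫⁻ x in Ω, rpowVariation h r L R f G x := by
  have hL0 : 0 ≤ L := (norm_nonneg _).trans (hL 0)
  have hΩae : ∀ᵐ x ∂volume.restrict Ω, x ∈ Ω := ae_restrict_mem hΩ
  obtain ⟨φ, hφ, hφf, hφG⟩ := hf.approx
  have hφm : ∀ k, Continuous (φ k) := fun k => (hφ k).smooth.continuous
  have hφ1 : ∀ k, ContDiff ℝ 1 (φ k) := fun k => (hφ k).smooth.of_le (by exact_mod_cast le_top)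
  have hφg : ∀ k, Continuous (gradient (φ k)) := fun k =>
    (InnerProductSpace.toDual ℝ (EuclideanSpace ℝ (Fin n))).symm.continuous.comp
      ((hφ1 k).continuous_fderiv one_ne_zero)
  have hfm := hf.integrable.aestronglyMeasurable
  have hGm := hf.integrable_grad.aestronglyMeasurable
  obtain ⟨ns, hns, hae⟩ := (tendstoInMeasure_of_tendsto_eLpNorm one_ne_zero
    (fun k => (hφm k).aestronglyMeasurable) hfm hφf).exists_seq_tendsto_ae
  have hcont : ∀ x, Continuous fun s => h s ^ r x := fun x =>
    hh.contDiff.continuous.rpow_const fun s => Or.inl (hh.pos s).ne'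
  have hcont' : ∀ x, Continuous fun s => h s ^ (r x - 1) := fun x =>
    hh.contDiff.continuous.rpow_const fun s => Or.inl (hh.pos s).ne'
  have hcontlog : Continuous fun s => Real.log (h s) :=
    hh.contDiff.continuous.log fun s => (hh.pos s).ne'
  have hfatou := Lp.eLpNorm_lim_le_liminf_eLpNorm (μ := volume.restrict Ω)
    (p := (NNReal.conjExponent n : ℝ≥0))
    (f := fun k x => h (φ (ns k) x) ^ r x - 1)
    (fun k => (hh.contDiff_rpow (hφ1 _) hr).continuous.aestronglyMeasurable)
    (fun x => h (f x) ^ r x - 1) (by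
      filter_upwards [hae] with x hx
      exact (((hcont x).tendsto _).comp hx).sub_const 1)
  have hlim1 : Tendsto (fun k => ∫⁻ x in Ω, rpowVariation h r L R (φ (ns k)) G x) atTop
      (𝓝 (∫⁻ x in Ω, rpowVariation h r L R f G x)) := by
    refine tendsto_lintegral_of_dominated_convergence'
      (fun x => ENNReal.ofReal (R * K ^ R) * ‖G x‖ₑ + ENNReal.ofReal (L * (K ^ R * Real.log K)))
      (fun k => aemeasurable_rpowVariation hh (hφm _).measurable.aemeasurable hGm.aemeasurable
        hr.continuous L R) (fun k => ?_) ?_ ?_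
    · filter_upwards [hΩae] with x hx
      exact rpowVariation_le hh hK hL0 hR (hrR x hx) G
    · rw [lintegral_add_right _ measurable_const, lintegral_const_mul' _ _ ENNReal.ofReal_ne_top,
        lintegral_const, Measure.restrict_apply_univ]
      exact ENNReal.add_ne_top.2 ⟨ENNReal.mul_ne_top ENNReal.ofReal_ne_top
        hf.integrable_grad.hasFiniteIntegral.ne, ENNReal.mul_ne_top ENNReal.ofReal_ne_top hΩfin⟩
    · filter_upwards [hae] with x hx
      refine Tendsto.add (ENNReal.Tendsto.mul_const ?_ (Or.inr enorm_ne_top)) ?_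
      · exact ENNReal.tendsto_ofReal ((((hcont' x).tendsto _).comp hx).const_mul R)
      · exact ENNReal.tendsto_ofReal
          (((((hcont x).mul hcontlog).tendsto _).comp hx).const_mul L)
  have hlim2 : Tendsto (fun k => ENNReal.ofReal (R * K ^ R) *
      ∫⁻ x in Ω, ‖gradient (φ (ns k)) x - G x‖ₑ) atTop (𝓝 0) := by
    have := (hφG.comp hns.tendsto_atTop)
    simp only [Function.comp_def, eLpNorm_one_eq_lintegral_enorm] at this
    simpa using ENNReal.Tendsto.const_mul this (Or.inr ENNReal.ofReal_ne_top)
  have hlim := ENNReal.Tendsto.const_mul (a := (sobolevConst n : ℝ≥0∞)) (hlim1.add hlim2)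
    (Or.inr ENNReal.coe_ne_top)
  rw [add_zero] at hlim
  refine hfatou.trans ?_
  rw [← hlim.liminf_eq]
  refine liminf_le_liminf (Eventually.of_forall fun k => ?_)
  refine (eLpNorm_rpow_sub_one_le_of_isTestFunction hn hΩ (hφ _) hh hr hL hr0 hrR).trans
    (mul_le_mul' le_rfl ?_)
  rw [← lintegral_const_mul' _ _ ENNReal.ofReal_ne_top, ← lintegral_add_left']
  · refine setLIntegral_mono' hΩ fun x hx => ?_
    exact rpowVariation_le_add hh hK hR (hrR x hx) G _
  · exact aemeasurable_rpowVariation hh (hφm _).measurable.aemeasurable hGm.aemeasurable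
        hr.continuous L R

/-! ### Pointwise Young-type inequalities -/

/-- Either `b ≤ η y^{1+m}`, and the first term suffices, or `y ≤ y^{1+m} < b/η`, and `y` can be
traded for `b/η`. The constant is uniform in `r` and in `p ≤ P`. -/
theorem rpow_sub_one_mul_le {y b η m r p P : ℝ} (hy : 1 ≤ y) (hb : 0 ≤ b) (hη : 0 < η)
    (hη1 : η ≤ 1) (hm : 0 ≤ m) (hrp : r ≤ p) (hp : 1 ≤ p) (hpP : p ≤ P) :
    y ^ (r - 1) * b ≤ η * y ^ (r + m) + η ^ (-P) * b ^ p := by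
  have hy0 : 0 < y := by linarith
  rcases le_or_gt b (η * y ^ (1 + m)) with h | h
  · have : y ^ (r - 1) * (η * y ^ (1 + m)) = η * y ^ (r + m) := by
      rw [mul_left_comm, ← Real.rpow_add hy0]; ring_nf
    have h2 : y ^ (r - 1) * b ≤ y ^ (r - 1) * (η * y ^ (1 + m)) := by gcongr
    have h3 : 0 ≤ η ^ (-P) * b ^ p := by positivity
    linarith
  · have h1 : y ≤ b / η := by
      rw [le_div_iff₀ hη, mul_comm]
      have : y ≤ y ^ (1 + m) := Real.self_le_rpow_of_one_le hy (by linarith)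
      nlinarith
    have hb0 : 0 < b := lt_of_le_of_lt (by positivity) h
    have h2 : y ^ (r - 1) ≤ (b / η) ^ (p - 1) :=
      Real.rpow_le_rpow_of_one_le_of_le hy h1 (by linarith) (by linarith)
    have h3 : (b / η) ^ (p - 1) * b = η ^ (1 - p) * b ^ p := by
      rw [Real.div_rpow hb hη.le, Real.rpow_sub_one hb0.ne', ← neg_sub p 1, Real.rpow_neg hη.le]
      field_simp
    have h4 : η ^ (1 - p) ≤ η ^ (-P) := Real.rpow_le_rpow_of_exponent_ge hη hη1 (by linarith)
    calc y ^ (r - 1) * b ≤ (b / η) ^ (p - 1) * b := by gcongr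
      _ = η ^ (1 - p) * b ^ p := h3
      _ ≤ η ^ (-P) * b ^ p := by gcongr
      _ ≤ _ := le_add_of_nonneg_left (by positivity)

/-- Either `log y ≤ η y^m`, or comparison with `log y ≤ (2/m) y^{m/2}` confines `y` to a bounded
range, where a constant suffices. -/
theorem rpow_mul_log_le {y η m r P : ℝ} (hy : 1 ≤ y) (hη : 0 < η) (hm : 0 < m) (hr : r ≤ P)
    (hP : 0 ≤ P) :
    y ^ r * Real.log y ≤ η * y ^ (r + m) + ((2 / (m * η)) ^ (2 / m)) ^ (P + 1) := by
  have hy0 : 0 < y := by linarith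
  rcases le_or_gt (Real.log y) (η * y ^ m) with h | h
  · have h2 : y ^ r * Real.log y ≤ y ^ r * (η * y ^ m) := by gcongr
    rw [mul_left_comm, ← Real.rpow_add hy0] at h2
    exact h2.trans (le_add_of_nonneg_right (by positivity))
  · have h1 := Real.log_le_rpow_div hy0.le (half_pos hm)
    have h3 : y ^ m = y ^ (m / 2) * y ^ (m / 2) := by rw [← Real.rpow_add hy0]; ring_nf
    have h4 : 0 < y ^ (m / 2) := by positivity
    have h5 : y ^ (m / 2) ≤ 2 / (m * η) := by
      rw [le_div_iff₀ (by positivity)]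
      rw [h3] at h
      have h6 := h.trans_le h1
      rw [lt_div_iff₀ (by positivity)] at h6
      have : (y ^ (m / 2) * (m * η)) * y ^ (m / 2) < 2 * y ^ (m / 2) := by linarith
      exact (lt_of_mul_lt_mul_right this h4.le).le
    have h7 : y ≤ (2 / (m * η)) ^ (2 / m) := by
      have := Real.rpow_le_rpow h4.le h5 (z := 2 / m) (by positivity)
      rwa [← Real.rpow_mul hy0.le, div_mul_div_cancel₀ (by norm_num), div_self hm.ne',
        Real.rpow_one] at this
    have h8 : y ^ r * Real.log y ≤ y ^ P * y :=
      mul_le_mul (Real.rpow_le_rpow_of_exponent_le hy hr)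
        ((Real.log_le_sub_one_of_pos hy0).trans (by linarith)) (Real.log_nonneg hy) (by positivity)
    calc _ ≤ y ^ P * y := h8
      _ = y ^ (P + 1) := (Real.rpow_add_one hy0.ne' P).symm
      _ ≤ ((2 / (m * η)) ^ (2 / m)) ^ (P + 1) := by gcongr
      _ ≤ _ := le_add_of_nonneg_left (by positivity)

theorem exists_rpow_sub_one_mul_add_le {L P m η : ℝ} (hL : 0 ≤ L) (hP : 0 ≤ P) (hm : 0 < m)
    (hη : 0 < η) :
    ∃ C : ℝ≥0, ∀ y b r p : ℝ, 1 ≤ y → 0 ≤ b → r ≤ p → 1 ≤ p → p ≤ P →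
      P * y ^ (r - 1) * b + L * (y ^ r * Real.log y) ≤ η * y ^ (r + m) + C * (1 + b ^ p) := by
  -- Each of the two terms may use half of `η`. The `+ 1` keeps the denominators positive when `P`
  -- or `L` is zero, and the cap at `1` is required by `rpow_sub_one_mul_le`.
  set η₁ := min 1 (η / (2 * (P + 1))) with hη₁
  set η₂ := η / (2 * (L + 1)) with hη₂
  have h1 : 0 < η₁ := lt_min one_pos (by positivity)
  have h2 : 0 < η₂ := by positivity
  have h3 : P * η₁ ≤ η / 2 := by
    have : η₁ ≤ η / (2 * (P + 1)) := min_le_right _ _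
    calc P * η₁ ≤ (P + 1) * (η / (2 * (P + 1))) := by gcongr; linarith
      _ = η / 2 := by field_simp
  have h4 : L * η₂ ≤ η / 2 := by
    calc L * η₂ ≤ (L + 1) * (η / (2 * (L + 1))) := by gcongr; linarith
      _ = η / 2 := by field_simp
  set C₁ := P * η₁ ^ (-P)
  set C₂ := L * ((2 / (m * η₂)) ^ (2 / m)) ^ (P + 1)
  have hC₁ : 0 ≤ C₁ := by positivity
  have hC₂ : 0 ≤ C₂ := by positivity
  refine ⟨⟨C₁ + C₂, by positivity⟩, fun y b r p hy hb hrp hp hpP => ?_⟩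
  have a1 := mul_le_mul_of_nonneg_left
    (rpow_sub_one_mul_le hy hb h1 (min_le_left _ _) hm.le hrp hp hpP) hP
  have a2 := mul_le_mul_of_nonneg_left (rpow_mul_log_le hy h2 hm (hrp.trans hpP) hP) hL
  have hY : 0 < y ^ (r + m) := Real.rpow_pos_of_pos (by linarith) _
  have hB : 0 ≤ b ^ p := Real.rpow_nonneg hb _
  have a3 := mul_le_mul_of_nonneg_right h3 hY.le
  have a4 := mul_le_mul_of_nonneg_right h4 hY.le
  change _ ≤ η * y ^ (r + m) + (C₁ + C₂) * (1 + b ^ p)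
  have a5 : P * (η₁ ^ (-P) * b ^ p) = C₁ * b ^ p := by ring
  nlinarith [mul_nonneg hC₂ hB]

/-! ### Interpolation, absorption and the truncated slice estimate -/

/-- Absorption of a finite quantity into the left-hand side. -/
theorem ENNReal.le_two_mul_of_le_half_add {a b : ℝ≥0∞} (ha : a ≠ ∞) (h : a ≤ 2⁻¹ * a + b) :
    a ≤ 2 * b := by
  have h2 : 2⁻¹ * a ≠ ∞ := ENNReal.mul_ne_top (by simp) ha
  have h3 : a = 2⁻¹ * a + 2⁻¹ * a := by
    rw [← add_mul, ENNReal.inv_two_add_inv_two, one_mul]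
  have h4 : 2⁻¹ * a ≤ b := (ENNReal.add_le_add_iff_left h2).1 (h3.symm.le.trans h)
  calc a = 2 * (2⁻¹ * a) := by
        rw [← mul_assoc, ENNReal.mul_inv_cancel (by simp) (by simp), one_mul]
    _ ≤ 2 * b := by gcongr

section Interpolation

variable {α : Type*} [MeasurableSpace α] {μ : Measure α}

/-- Hölder's inequality for `y^{2/n} · y^r` with exponents `n` and `n/(n-1)`: the `n`-th power of
the first factor is `y²`. -/
theorem lintegral_rpow_add_two_div_le {n : ℕ} (hn : 2 ≤ n) {y r : α → ℝ} (hy : ∀ x, 1 ≤ y x)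
    (hym : AEMeasurable y μ) (hrm : AEMeasurable r μ) :
    ∫⁻ x, ENNReal.ofReal (y x ^ (r x + 2 / n)) ∂μ ≤
      (∫⁻ x, ENNReal.ofReal (y x ^ 2) ∂μ) ^ (1 / (n : ℝ)) *
        (eLpNorm (fun x => y x ^ r x - 1) (NNReal.conjExponent n : ℝ≥0) μ +
          eLpNorm (fun _ => (1 : ℝ)) (NNReal.conjExponent n : ℝ≥0) μ) := by
  have hconj : NNReal.HolderConjugate n (NNReal.conjExponent n) :=
    .conjExponent (by exact_mod_cast hn)
  have hn0 : (n : ℝ) ≠ 0 := by positivity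
  have hy0 : ∀ x, 0 < y x := fun x => zero_lt_one.trans_le (hy x)
  have key := ENNReal.lintegral_mul_le_Lp_mul_Lq μ hconj.coe
    (f := fun x => ENNReal.ofReal (y x ^ (2 / (n : ℝ)))) (g := fun x => ENNReal.ofReal (y x ^ r x))
    (hym.pow_const _).ennreal_ofReal (hym.pow hrm).ennreal_ofReal
  have e1 : ∫⁻ x, ENNReal.ofReal (y x ^ (r x + 2 / n)) ∂μ =
      ∫⁻ x, ((fun x => ENNReal.ofReal (y x ^ (2 / (n : ℝ)))) *
        fun x => ENNReal.ofReal (y x ^ r x)) x ∂μ := by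
    refine lintegral_congr fun x => ?_
    rw [Pi.mul_apply, ← ENNReal.ofReal_mul (by have := hy0 x; positivity), add_comm,
      Real.rpow_add (hy0 x)]
  have e2 : ∫⁻ x, ENNReal.ofReal (y x ^ (2 / (n : ℝ))) ^ (n : ℝ) ∂μ =
      ∫⁻ x, ENNReal.ofReal (y x ^ 2) ∂μ := by
    refine lintegral_congr fun x => ?_
    rw [ENNReal.ofReal_rpow_of_pos (Real.rpow_pos_of_pos (hy0 x) _), ← Real.rpow_mul (hy0 x).le,
      div_mul_cancel₀ _ hn0, Real.rpow_two]
  have e3 : (∫⁻ x, ENNReal.ofReal (y x ^ r x) ^ ((NNReal.conjExponent n : ℝ≥0) : ℝ) ∂μ) ^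
      (1 / ((NNReal.conjExponent n : ℝ≥0) : ℝ)) =
      eLpNorm (fun x => y x ^ r x) (NNReal.conjExponent n : ℝ≥0) μ := by
    rw [eLpNorm_nnreal_eq_lintegral hconj.symm.pos.ne']
    congr 1
    refine lintegral_congr fun x => ?_
    rw [Real.enorm_of_nonneg (Real.rpow_pos_of_pos (hy0 x) _).le]
  rw [e1]
  refine key.trans ?_
  simp only [NNReal.coe_natCast] at *
  rw [e2, e3]
  refine mul_le_mul' le_rfl ?_
  have := eLpNorm_add_le (p := (NNReal.conjExponent n : ℝ≥0))
    ((hym.pow hrm).sub_const 1).aestronglyMeasurable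
    (aestronglyMeasurable_const (b := (1 : ℝ)) (μ := μ))
    (by exact_mod_cast hconj.symm.lt.le)
  refine (le_of_eq ?_).trans this
  congr 1
  ext x
  simp

end Interpolation

variable {n : ℕ}

theorem lintegral_height_sq_le {h : ℝ → ℝ} (hsq : ∀ s, h s ^ 2 ≤ 1 + s ^ 2)
    {Ω : Set (EuclideanSpace ℝ (Fin n))} {f : EuclideanSpace ℝ (Fin n) → ℝ} :
    ∫⁻ x in Ω, ENNReal.ofReal (h (f x) ^ 2) ≤
      volume Ω + eLpNorm f 2 (volume.restrict Ω) ^ 2 := by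
  have e : eLpNorm f 2 (volume.restrict Ω) ^ 2 = ∫⁻ x in Ω, ‖f x‖ₑ ^ 2 := by
    have := eLpNorm_nnreal_pow_eq_lintegral (f := f) (μ := volume.restrict Ω) (p := 2) two_ne_zero
    simpa using this
  rw [e]
  calc ∫⁻ x in Ω, ENNReal.ofReal (h (f x) ^ 2) ≤ ∫⁻ x in Ω, (1 + ‖f x‖ₑ ^ 2) := by
        refine lintegral_mono fun x => ?_
        refine (ENNReal.ofReal_le_ofReal (hsq _)).trans ?_
        rw [ENNReal.ofReal_add zero_le_one (sq_nonneg _), ENNReal.ofReal_one,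
          ← sq_abs, ENNReal.ofReal_pow (abs_nonneg _), ← Real.norm_eq_abs, ofReal_norm]
    _ = _ := by
        rw [lintegral_add_left measurable_const, lintegral_const, one_mul,
          Measure.restrict_apply_univ]

/-- The height bound `K` is quantified after `C`: it serves only to make the absorbed integral
finite, so the estimate survives removal of the truncation. -/
theorem exists_lintegral_height_rpow_le (hn : 2 ≤ n) {L P : ℝ} (hL : 0 ≤ L) (hP : 0 ≤ P)
    (M V : ℝ≥0) :
    ∃ C : ℝ≥0, ∀ (Ω : Set (EuclideanSpace ℝ (Fin n))) (f : EuclideanSpace ℝ (Fin n) → ℝ)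
      (G : EuclideanSpace ℝ (Fin n) → EuclideanSpace ℝ (Fin n))
      (p r : EuclideanSpace ℝ (Fin n) → ℝ) (h : ℝ → ℝ) (K : ℝ),
      MeasurableSet Ω → volume Ω = V → MemW₀11 Ω f G →
      eLpNorm f 2 (volume.restrict Ω) ^ 2 ≤ M → ContDiff ℝ 1 r → (∀ x, ‖fderiv ℝ r x‖ ≤ L) →
      (∀ x ∈ Ω, 0 ≤ r x) → (∀ x ∈ Ω, r x ≤ p x) → (∀ x ∈ Ω, 1 ≤ p x) → (∀ x ∈ Ω, p x ≤ P) →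
      IsSmoothHeight h → (∀ s, h s ≤ K) → (∀ s, h s ^ 2 ≤ 1 + s ^ 2) →
      ∫⁻ x in Ω, ENNReal.ofReal (h (f x) ^ (r x + 2 / n)) ≤
        C * (1 + ∫⁻ x in Ω, ENNReal.ofReal (‖G x‖ ^ p x)) := by
  have hconj : NNReal.HolderConjugate n (NNReal.conjExponent n) :=
    .conjExponent (by exact_mod_cast hn)
  set B : ℝ≥0 := (V + M) ^ (1 / (n : ℝ)) with hB
  set S := sobolevConst n
  set W : ℝ≥0 := V ^ (1 / ((NNReal.conjExponent n : ℝ≥0) : ℝ)) with hW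
  -- Chosen so that the Hölder factor `B` times the Sobolev constant `S` times `η` is at most `1/2`.
  set η : ℝ≥0 := (2 * (B * S + 1))⁻¹ with hη
  have hη0 : 0 < η := by positivity
  have hηB : B * S * η ≤ 2⁻¹ := by
    rw [hη, mul_inv, mul_left_comm]
    refine mul_le_of_le_one_right (by positivity) ?_
    rw [← div_eq_mul_inv]
    exact div_le_one_of_le₀ (by simp) (by positivity)
  obtain ⟨C, hC⟩ := exists_rpow_sub_one_mul_add_le (m := 2 / n) hL hP (by positivity)
    (NNReal.coe_pos.2 hη0)
  refine ⟨2 * (B * (S * (C * (V + 1)) + W)), fun Ω f G p r h K hΩ hV hf hM hr hrL hr0 hrp hp1 hpP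
    hh hK hsq => ?_⟩
  set A := ∫⁻ x in Ω, ENNReal.ofReal (‖G x‖ ^ p x)
  set I := ∫⁻ x in Ω, ENNReal.ofReal (h (f x) ^ (r x + 2 / n)) with hI
  have hfm := hf.integrable.aestronglyMeasurable.aemeasurable
  have hhm := hh.contDiff.continuous.measurable.comp_aemeasurable hfm
  have hrm : AEMeasurable r (volume.restrict Ω) := hr.continuous.measurable.aemeasurable
  have hΩfin : volume Ω ≠ ∞ := by rw [hV]; exact ENNReal.coe_ne_top
  have hIfin : I ≠ ∞ := by
    have : I ≤ ∫⁻ x in Ω, ENNReal.ofReal (K ^ (P + 2 / n)) := by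
      refine setLIntegral_mono' hΩ fun x hx => ENNReal.ofReal_le_ofReal ?_
      exact Real.rpow_le_rpow_of_one_le_of_le (hh.one_le _) (hK _)
        (by linarith [hrp x hx, hpP x hx]) (by positivity)
    refine ne_top_of_le_ne_top ?_ this
    rw [lintegral_const, Measure.restrict_apply_univ]
    exact ENNReal.mul_ne_top ENNReal.ofReal_ne_top hΩfin
  have h1 := lintegral_rpow_add_two_div_le hn (fun x => hh.one_le (f x)) hhm hrm
  have h2 : (∫⁻ x in Ω, ENNReal.ofReal (h (f x) ^ 2)) ^ (1 / (n : ℝ)) ≤ B := by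
    rw [hB, ENNReal.coe_rpow_of_nonneg _ (by positivity)]
    gcongr
    refine (lintegral_height_sq_le hsq).trans ?_
    rw [ENNReal.coe_add, hV]
    gcongr
  have h3 : eLpNorm (fun _ => (1 : ℝ)) (NNReal.conjExponent n : ℝ≥0) (volume.restrict Ω) = W := by
    rw [eLpNorm_nnreal_eq_lintegral hconj.symm.pos.ne', hW,
      ENNReal.coe_rpow_of_nonneg _ (by positivity)]
    simp [hV]
  have h4 := hf.eLpNorm_rpow_sub_one_le hn hΩ hΩfin hh hK hr hrL hP hr0
    (fun x hx => (hrp x hx).trans (hpP x hx))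
  have h5 : ∫⁻ x in Ω, rpowVariation h r L P f G x ≤ η * I + C * (V + A) := by
    have hIm : AEMeasurable (fun x => ENNReal.ofReal (h (f x) ^ (r x + 2 / n)))
      (volume.restrict Ω) := (hhm.pow (hrm.add_const _)).ennreal_ofReal
    have hA1 : V + A = ∫⁻ x in Ω, (1 + ENNReal.ofReal (‖G x‖ ^ p x)) := by
      rw [lintegral_add_left measurable_const, lintegral_const, one_mul,
          Measure.restrict_apply_univ, hV]
    rw [hA1, ← lintegral_const_mul' _ _ ENNReal.coe_ne_top,
      ← lintegral_const_mul' _ _ ENNReal.coe_ne_top, ← lintegral_add_left' (hIm.const_mul _)]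
    refine setLIntegral_mono' hΩ fun x hx => ?_
    have hp := hh.pos (f x)
    have hlog : 0 ≤ Real.log (h (f x)) := Real.log_nonneg (hh.one_le _)
    have := hC (h (f x)) ‖G x‖ (r x) (p x) (hh.one_le _) (norm_nonneg _) (hrp x hx) (hp1 x hx)
      (hpP x hx)
    have := ENNReal.ofReal_le_ofReal this
    rw [ENNReal.ofReal_add (by positivity) (by positivity),
      ENNReal.ofReal_add (by positivity) (by positivity),
      ENNReal.ofReal_mul (q := ‖G x‖) (by positivity), ofReal_norm,
      ENNReal.ofReal_mul (p := (η : ℝ)) (by positivity),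
      ENNReal.ofReal_mul (p := (C : ℝ)) (by positivity),
      ENNReal.ofReal_add zero_le_one (by positivity), ENNReal.ofReal_coe_nnreal,
      ENNReal.ofReal_coe_nnreal, ENNReal.ofReal_one] at this
    exact this
  have h6 : I ≤ 2⁻¹ * I + B * (S * (C * (V + A)) + W) := by
    calc I ≤ B * (S * (η * I + C * (V + A)) + W) := by
          refine h1.trans (mul_le_mul' h2 (add_le_add (h4.trans (mul_le_mul' le_rfl h5)) h3.le))
      _ = (B * S * η : ℝ≥0) * I + B * (S * (C * (V + A)) + W) := by push_cast; ring
      _ ≤ (2⁻¹ : ℝ≥0) * I + B * (S * (C * (V + A)) + W) := by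
          gcongr
      _ = _ := by simp
  refine (ENNReal.le_two_mul_of_le_half_add hIfin h6).trans ?_
  push_cast
  have h7 : (V : ℝ≥0∞) + A ≤ (V + 1) * (1 + A) := by
    have : ((V : ℝ≥0∞) + 1) * (1 + A) = V + A + (V * A + 1) := by ring
    rw [this]
    exact le_self_add
  have h8 : (W : ℝ≥0∞) ≤ W * (1 + A) := le_mul_of_one_le_right' le_self_add
  calc (2 : ℝ≥0∞) * (B * (S * (C * (V + A)) + W))
      ≤ 2 * (B * (S * (C * ((V + 1) * (1 + A))) + W * (1 + A))) := by gcongr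
    _ = _ := by ring

/-! ### The truncated heights and removal of the truncation -/

/-- The height function `√(1 + s²)`, smoothly truncated at height `√(1 + 1 / c)`. -/
noncomputable def truncHeight (c s : ℝ) : ℝ := Real.sqrt (1 + s ^ 2 / (1 + c * s ^ 2))

theorem isSmoothHeight_truncHeight {c : ℝ} (hc : 0 ≤ c) : IsSmoothHeight (truncHeight c) := by
  have hd : ∀ s : ℝ, 0 < 1 + c * s ^ 2 := fun s => by positivity
  have hw : ∀ s : ℝ, 0 < 1 + s ^ 2 / (1 + c * s ^ 2) := fun s => by have := hd s; positivity
  refine ⟨?_, ?_, fun s => ?_, fun s => ?_⟩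
  · exact ContDiff.sqrt (contDiff_const.add ((contDiff_id.pow 2).div
      (contDiff_const.add (contDiff_const.mul (contDiff_id.pow 2))) fun s => (hd s).ne'))
      fun s => (hw s).ne'
  · simp [truncHeight]
  · rw [truncHeight, Real.one_le_sqrt]
    have := hd s
    exact le_add_of_nonneg_right (by positivity)
  · have h1 : HasDerivAt (fun s : ℝ => s ^ 2) (2 * s) s := by simpa using hasDerivAt_pow 2 s
    have h2 : HasDerivAt (fun s : ℝ => 1 + s ^ 2 / (1 + c * s ^ 2))
        ((2 * s * (1 + c * s ^ 2) - s ^ 2 * (c * (2 * s))) / (1 + c * s ^ 2) ^ 2) s :=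
      (h1.div ((h1.const_mul c).const_add 1) (hd s).ne').const_add 1
    have h3 : deriv (truncHeight c) s = s / ((1 + c * s ^ 2) ^ 2 * truncHeight c s) := by
      refine (h2.sqrt (hw s).ne').deriv.trans ?_
      have h5 := (Real.sqrt_pos.2 (hw s)).ne'
      have h6 := (hd s).ne'
      rw [truncHeight, div_div, div_eq_div_iff (by positivity) (by positivity)]
      ring
    have hp : 0 < truncHeight c s := Real.sqrt_pos.2 (hw s)
    have hd' := hd s
    rw [h3, abs_div, abs_of_pos (a := _ * _) (by positivity), div_le_one (by positivity)]
    -- After squaring, the slope bound reads `s² ≤ (1 + cs²)³ (1 + cs² + s²)`.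
    refine abs_le_of_sq_le_sq ?_ (by positivity)
    have h7 : truncHeight c s ^ 2 = 1 + s ^ 2 / (1 + c * s ^ 2) := Real.sq_sqrt (hw s).le
    rw [mul_pow, h7]
    have h8 : (1 + c * s ^ 2) * (1 + s ^ 2 / (1 + c * s ^ 2)) = 1 + c * s ^ 2 + s ^ 2 := by
      field_simp
    have h9 : 1 ≤ (1 + c * s ^ 2) ^ 3 := one_le_pow₀ (le_add_of_nonneg_right (by positivity))
    calc s ^ 2 ≤ 1 * (1 + c * s ^ 2 + s ^ 2) := by nlinarith
      _ ≤ (1 + c * s ^ 2) ^ 3 * (1 + c * s ^ 2 + s ^ 2) := by gcongr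
      _ = ((1 + c * s ^ 2) ^ 2) ^ 2 * (1 + s ^ 2 / (1 + c * s ^ 2)) := by rw [← h8]; ring

theorem truncHeight_le {c : ℝ} (hc : 0 < c) (s : ℝ) : truncHeight c s ≤ Real.sqrt (1 + 1 / c) := by
  refine Real.sqrt_le_sqrt (add_le_add le_rfl ?_)
  rw [div_le_div_iff₀ (by positivity) hc]
  nlinarith

theorem truncHeight_sq_le {c : ℝ} (hc : 0 ≤ c) (s : ℝ) : truncHeight c s ^ 2 ≤ 1 + s ^ 2 := by
  rw [truncHeight, Real.sq_sqrt (by positivity)]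
  gcongr
  exact div_le_self (sq_nonneg s) (le_add_of_nonneg_right (by positivity))

theorem tendsto_truncHeight (s : ℝ) :
    Tendsto (fun k : ℕ => truncHeight (1 / ((k : ℝ) + 1)) s) atTop
      (𝓝 (Real.sqrt (1 + s ^ 2))) := by
  have h1 := (tendsto_one_div_add_atTop_nhds_zero_nat (𝕜 := ℝ)).mul_const (s ^ 2)
  have h2 := ((tendsto_const_nhds (x := s ^ 2)).div (h1.const_add 1) (by simp)).const_add 1
  have := (Real.continuous_sqrt.tendsto _).comp h2
  simpa [truncHeight, Function.comp_def] using this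

theorem exists_lintegral_rpow_le {n : ℕ} (hn : 2 ≤ n) {L P : ℝ} (hL : 0 ≤ L) (hP : 0 ≤ P)
    (M V : ℝ≥0) :
    ∃ C : ℝ≥0, ∀ (Ω : Set (EuclideanSpace ℝ (Fin n))) (f : EuclideanSpace ℝ (Fin n) → ℝ)
      (G : EuclideanSpace ℝ (Fin n) → EuclideanSpace ℝ (Fin n))
      (p q r : EuclideanSpace ℝ (Fin n) → ℝ),
      MeasurableSet Ω → volume Ω = V → MemW₀11 Ω f G →
      eLpNorm f 2 (volume.restrict Ω) ^ 2 ≤ M → ContDiff ℝ 1 r → (∀ x, ‖fderiv ℝ r x‖ ≤ L) →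
      (∀ x ∈ Ω, 0 ≤ r x) → (∀ x ∈ Ω, r x ≤ p x) → (∀ x ∈ Ω, 1 ≤ p x) → (∀ x ∈ Ω, p x ≤ P) →
      (∀ x ∈ Ω, 0 ≤ q x) → (∀ x ∈ Ω, q x ≤ r x + 2 / n) →
      ∫⁻ x in Ω, ENNReal.ofReal (‖f x‖ ^ q x) ≤
        C * (1 + ∫⁻ x in Ω, ENNReal.ofReal (‖G x‖ ^ p x)) := by
  obtain ⟨C, hC⟩ := exists_lintegral_height_rpow_le hn hL hP M V
  refine ⟨C, fun Ω f G p q r hΩ hV hf hM hr hrL hr0 hrp hp1 hpP hq0 hqr => ?_⟩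
  have hc : ∀ k : ℕ, (0 : ℝ) < 1 / ((k : ℝ) + 1) := fun k => by positivity
  set F : ℕ → EuclideanSpace ℝ (Fin n) → ℝ≥0∞ := fun k x =>
    ENNReal.ofReal (truncHeight (1 / ((k : ℝ) + 1)) (f x) ^ (r x + 2 / n)) with hF
  have hlim : ∀ x, Tendsto (fun k => F k x) atTop
      (𝓝 (ENNReal.ofReal (Real.sqrt (1 + f x ^ 2) ^ (r x + 2 / n)))) := fun x =>
    ENNReal.tendsto_ofReal ((tendsto_truncHeight (f x)).rpow_const
      (Or.inl (by positivity)))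
  have hfm := hf.integrable.aestronglyMeasurable.aemeasurable
  have hFm : ∀ k, AEMeasurable (F k) (volume.restrict Ω) := fun k =>
    (((isSmoothHeight_truncHeight (hc k).le).contDiff.continuous.measurable.comp_aemeasurable
      hfm).pow (hr.continuous.measurable.add_const _).aemeasurable).ennreal_ofReal
  calc ∫⁻ x in Ω, ENNReal.ofReal (‖f x‖ ^ q x)
      ≤ ∫⁻ x in Ω, liminf (fun k => F k x) atTop := by
        refine setLIntegral_mono' hΩ fun x hx => ?_
        rw [(hlim x).liminf_eq]
        refine ENNReal.ofReal_le_ofReal ?_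
        have h1 : 1 ≤ Real.sqrt (1 + f x ^ 2) :=
          Real.one_le_sqrt.2 (le_add_of_nonneg_right (sq_nonneg _))
        have h2 : ‖f x‖ ≤ Real.sqrt (1 + f x ^ 2) := by
          rw [Real.norm_eq_abs]
          exact Real.abs_le_sqrt (by linarith)
        exact (Real.rpow_le_rpow (norm_nonneg _) h2 (hq0 x hx)).trans
          (Real.rpow_le_rpow_of_exponent_le h1 (hqr x hx))
    _ ≤ liminf (fun k => ∫⁻ x in Ω, F k x) atTop := lintegral_liminf_le' hFm
    _ ≤ C * (1 + ∫⁻ x in Ω, ENNReal.ofReal (‖G x‖ ^ p x)) := by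
        refine (liminf_le_liminf (Eventually.of_forall fun k => ?_)).trans
          (liminf_const _).le
        exact hC Ω f G p r _ _ hΩ hV hf hM hr hrL hr0 hrp hp1 hpP
          (isSmoothHeight_truncHeight (hc k).le) (truncHeight_le (hc k))
          (truncHeight_sq_le (hc k).le)

/-! ### Smoothing the exponent from below -/

section Regularization

variable {E : Type*} [NormedAddCommGroup E]

/-- Inf-convolution of `p` with a cone of slope `(b - a)/ρ`. Points within `ρ` lower the value by at
most `δ`; for farther points the cone has already risen by the full oscillation `b - a`, so they
cannot lower it. -/
theorem exists_lipschitzWith_le_of_modulus {S : Set E} (hS : S.Nonempty) {p : E → ℝ}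
    {a b ρ δ : ℝ} (hρ : 0 < ρ) (ha : ∀ x ∈ S, a ≤ p x) (hb : ∀ x ∈ S, p x ≤ b)
    (hδ : ∀ x ∈ S, ∀ y ∈ S, ‖x - y‖ < ρ → |p x - p y| ≤ δ) :
    ∃ q : E → ℝ, LipschitzWith ((b - a) / ρ).toNNReal q ∧
      ∀ x ∈ S, p x - δ ≤ q x ∧ q x ≤ p x := by
  obtain ⟨x₀, hx₀⟩ := hS
  have hab : 0 ≤ b - a := by linarith [ha x₀ hx₀, hb x₀ hx₀]
  have : Nonempty S := ⟨⟨x₀, hx₀⟩⟩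
  set L := (b - a) / ρ with hL
  have hL0 : 0 ≤ L := by positivity
  have hbdd : ∀ x : E, BddBelow (range fun y : S => p y + L * ‖x - y‖) := fun _ =>
    ⟨a, forall_mem_range.2 fun y => (ha y y.2).trans
      (le_add_of_nonneg_right (mul_nonneg hL0 (norm_nonneg _)))⟩
  refine ⟨fun x => ⨅ y : S, (p y + L * ‖x - y‖), LipschitzWith.of_le_add_mul _ fun x x' => ?_,
    fun x hx => ⟨le_ciInf fun y => ?_, ?_⟩⟩
  · rw [Real.coe_toNNReal _ hL0, ← sub_le_iff_le_add]
    refine le_ciInf fun y => ?_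
    rw [sub_le_iff_le_add]
    refine (ciInf_le (hbdd x) y).trans ?_
    have : ‖x - y‖ ≤ ‖x' - y‖ + dist x x' := by
      rw [← dist_eq_norm, ← dist_eq_norm, add_comm]
      exact dist_triangle _ _ _
    nlinarith
  · rcases lt_or_ge ‖x - y‖ ρ with h | h
    · have h1 := (abs_le.1 (hδ x hx y y.2 h)).2
      have h2 : 0 ≤ L * ‖x - y‖ := by positivity
      linarith
    · have h1 : b - a ≤ L * ‖x - y‖ := by
        calc b - a = L * ρ := by rw [hL]; field_simp
          _ ≤ _ := by gcongr
      have h2 := (abs_nonneg _).trans (hδ x hx x hx (by simpa using hρ))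
      linarith [hb x hx, ha y y.2]
  · simpa using ciInf_le (hbdd x) ⟨x, hx⟩

variable [NormedSpace ℝ E] [FiniteDimensional ℝ E]

/-- Mollification at scale `δ / (L + 1)`: averaging translates preserves the Lipschitz constant and
moves values by at most `δ`. -/
theorem LipschitzWith.exists_contDiff_abs_sub_le {q : E → ℝ} {L : ℝ≥0} (hq : LipschitzWith L q)
    {δ : ℝ} (hδ : 0 < δ) :
    ∃ r : E → ℝ, ContDiff ℝ 1 r ∧ LipschitzWith L r ∧ ∀ x, |r x - q x| ≤ δ := by
  borelize E
  set μ : Measure E := Measure.addHaar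
  have hσ : 0 < δ / (L + 1) := by positivity
  let φ : ContDiffBump (0 : E) := ⟨δ / (L + 1) / 2, δ / (L + 1), by positivity, by linarith⟩
  have hint : ∀ x, Integrable (fun t => φ.normed μ t * q (x - t)) μ := fun x =>
    Continuous.integrable_of_hasCompactSupport
      (φ.continuous_normed.mul (hq.continuous.comp (continuous_const.sub continuous_id)))
      φ.hasCompactSupport_normed.mul_right
  refine ⟨convolution (φ.normed μ) q (ContinuousLinearMap.lsmul ℝ ℝ) μ, ?_, ?_, fun x => ?_⟩
  · exact_mod_cast φ.hasCompactSupport_normed.contDiff_convolution_left _ (n := 1) φ.contDiff_normed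
      hq.continuous.locallyIntegrable
  · refine LipschitzWith.of_dist_le_mul fun x y => ?_
    simp only [convolution, ContinuousLinearMap.lsmul_apply, smul_eq_mul]
    rw [dist_eq_norm, ← integral_sub (hint x) (hint y)]
    refine (norm_integral_le_of_norm_le (φ.integrable_normed.mul_const (L * dist x y))
      (Eventually.of_forall fun t => ?_)).trans ?_
    · rw [← mul_sub, norm_mul, Real.norm_of_nonneg (φ.nonneg_normed t), ← dist_eq_norm]
      refine mul_le_mul_of_nonneg_left ?_ (φ.nonneg_normed t)
      simpa using hq.dist_le_mul (x - t) (y - t)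
    · rw [integral_mul_const, φ.integral_normed, one_mul]
  · rw [← Real.dist_eq]
    refine φ.dist_normed_convolution_le hq.continuous.aestronglyMeasurable fun y hy => ?_
    refine (hq.dist_le_mul y x).trans ?_
    have h1 : dist y x < δ / (L + 1) := hy
    calc (L : ℝ) * dist y x ≤ (L + 1) * (δ / (L + 1)) := by gcongr; linarith
      _ = δ := by field_simp

theorem exists_contDiff_le_of_modulus {S : Set E} (hS : S.Nonempty) {p : E → ℝ}
    {a b ρ δ : ℝ} (hρ : 0 < ρ) (hδ0 : 0 < δ) (ha : ∀ x ∈ S, a ≤ p x) (hb : ∀ x ∈ S, p x ≤ b)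
    (hδ : ∀ x ∈ S, ∀ y ∈ S, ‖x - y‖ < ρ → |p x - p y| ≤ δ) :
    ∃ r : E → ℝ, ContDiff ℝ 1 r ∧ (∀ x, ‖fderiv ℝ r x‖ ≤ ((b - a) / ρ).toNNReal) ∧
      ∀ x ∈ S, p x - 2 * δ ≤ r x ∧ r x ≤ p x := by
  obtain ⟨q, hqL, hq⟩ := exists_lipschitzWith_le_of_modulus hS hρ ha hb hδ
  obtain ⟨r, hr, hrL, hrq⟩ := hqL.exists_contDiff_abs_sub_le (half_pos hδ0)
  -- The mollification is within `δ/2` of `q`; shifting it down by `δ/2` restores `r ≤ p` at a total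
  -- loss of at most `2δ`.
  refine ⟨fun x => r x - δ / 2, hr.sub contDiff_const, fun x => ?_, fun x hx => ?_⟩
  · rw [fderiv_sub_const]
    exact norm_fderiv_le_of_lipschitz ℝ hrL
  · have := abs_le.1 (hrq x)
    constructor <;> linarith [(hq x hx).1, (hq x hx).2]

/-- The gradient bound is fixed before the set and the exponent, which makes it common to all time
slices and all admissible `p`. -/
theorem exists_uniform_contDiff_exponent {ω : ℝ → ℝ} (hω : Tendsto ω (𝓝[>] 0) (𝓝 0)) (a b : ℝ)
    {δ : ℝ} (hδ : 0 < δ) :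
    ∃ L : ℝ≥0, ∀ (S : Set E) (p : E → ℝ), S.Nonempty →
      (∀ x ∈ S, ∀ y ∈ S, |p x - p y| ≤ ω ‖x - y‖) → (∀ x ∈ S, a ≤ p x) → (∀ x ∈ S, p x ≤ b) →
      ∃ r : E → ℝ, ContDiff ℝ 1 r ∧ (∀ x, ‖fderiv ℝ r x‖ ≤ L) ∧
        ∀ x ∈ S, p x - δ ≤ r x ∧ r x ≤ p x := by
  obtain ⟨ρ, hρ, hωρ⟩ := mem_nhdsGT_iff_exists_Ioo_subset.1
    (hω.eventually (eventually_le_nhds (half_pos hδ)))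
  refine ⟨((b - a) / ρ).toNNReal, fun S p hS hp ha hb => ?_⟩
  have := exists_contDiff_le_of_modulus hS hρ (half_pos hδ) ha hb fun x hx y hy hxy => ?_
  · simpa [mul_div_cancel₀] using this
  -- The limit at `0⁺` says nothing about `ω 0`, so coinciding points are treated separately.
  · rcases eq_or_ne x y with rfl | hne
    · simpa using (half_pos hδ).le
    · exact (hp x hx y hy).trans (hωρ ⟨norm_pos_iff.2 (sub_ne_zero.2 hne), hxy⟩)

end Regularization

/-! ### From slices to the cylinder and to the Luxemburg norm -/

/-- For `a ≥ 1` and `q ≥ 1` one has `a^{-q} ≤ a^{-1}`, so dividing by `a = max 1 K` scales the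
modular by at least `1/K`-type decay, down to at most `1`. -/
theorem luxemburgNorm_le_max {α F : Type*} [MeasureSpace α] [NormedAddCommGroup F]
    [NormedSpace ℝ F] {S : Set α} (hS : MeasurableSet S) {q : α → ℝ} (hq : ∀ z ∈ S, 1 ≤ q z)
    {f : α → F} {K : ℝ≥0} (hK : varModular S q f ≤ K) :
    luxemburgNorm S q f ≤ (max 1 K : ℝ≥0) := by
  set a : ℝ≥0 := max 1 K
  have ha1 : 1 ≤ a := le_max_left _ _
  have ha0 : 0 < a := zero_lt_one.trans_le ha1
  refine iInf₂_le a ⟨ha0, ?_⟩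
  calc varModular S q (fun z => (a : ℝ)⁻¹ • f z)
      ≤ ∫⁻ z in S, ((a⁻¹ : ℝ≥0) : ℝ≥0∞) * ENNReal.ofReal (‖f z‖ ^ q z) := by
        refine setLIntegral_mono' hS fun z hz => ?_
        rw [← ENNReal.ofReal_coe_nnreal, ← ENNReal.ofReal_mul (NNReal.coe_nonneg _)]
        refine ENNReal.ofReal_le_ofReal ?_
        rw [norm_smul, Real.norm_of_nonneg (by positivity),
          Real.mul_rpow (by positivity) (norm_nonneg _)]
        refine mul_le_mul_of_nonneg_right ?_ (by positivity)
        have h1 : (a : ℝ)⁻¹ ≤ 1 := inv_le_one_of_one_le₀ (by exact_mod_cast ha1)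
        simpa using Real.rpow_le_rpow_of_exponent_ge (by positivity) h1 (hq z hz)
    _ = ((a⁻¹ : ℝ≥0) : ℝ≥0∞) * varModular S q f :=
        lintegral_const_mul' _ _ ENNReal.coe_ne_top
    _ ≤ ((a⁻¹ : ℝ≥0) : ℝ≥0∞) * (a : ℝ≥0∞) := by
        gcongr
        exact hK.trans (by exact_mod_cast le_max_right _ _)
    _ = 1 := by rw [← ENNReal.coe_mul, inv_mul_cancel₀ ha0.ne', ENNReal.coe_one]

theorem varModular_spaceTimeCylinder {n : ℕ} {F : Type*} [NormedAddCommGroup F]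
    {Ω : Set (EuclideanSpace ℝ (Fin n))} (hΩ : MeasurableSet Ω) {T : ℝ}
    {q : EuclideanSpace ℝ (Fin n) × ℝ → ℝ} (hq : ContinuousOn q (spaceTimeCylinder Ω T))
    {f : EuclideanSpace ℝ (Fin n) × ℝ → F}
    (hf : AEStronglyMeasurable f (volume.restrict (spaceTimeCylinder Ω T))) :
    varModular (spaceTimeCylinder Ω T) q f =
      ∫⁻ t in Ioo 0 T, varModular Ω (fun x => q (x, t)) (fun x => f (x, t)) := by
  have hm : AEMeasurable (fun z => ENNReal.ofReal (‖f z‖ ^ q z))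
      (volume.restrict (spaceTimeCylinder Ω T)) :=
    (hf.norm.aemeasurable.pow
      (hq.aemeasurable (hΩ.prod measurableSet_Ioo))).ennreal_ofReal
  have hv : volume.restrict (spaceTimeCylinder Ω T) =
      (volume.restrict Ω).prod (volume.restrict (Ioo 0 T)) := by
    rw [Measure.prod_restrict]
    rfl
  rw [hv] at hm
  unfold varModular
  rw [hv, lintegral_prod_symm _ hm]

theorem mainTheorem6 (n : ℕ) (hn : 2 ≤ n) (ε : ℝ) (hε : 0 < ε) (hεn : ε < 1 / (n : ℝ))
    (M : ℝ≥0) (pmin pmax : ℝ) (hpmin : 1 < pmin) (ω : ℝ → ℝ) (V : ℝ≥0) (T : ℝ) (hT : 0 < T) :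
    ∃ C : ℝ≥0,
      ∀ (Ω : Set (EuclideanSpace ℝ (Fin n))) (p : EuclideanSpace ℝ (Fin n) × ℝ → ℝ)
        (u : EuclideanSpace ℝ (Fin n) × ℝ → ℝ)
        (g : EuclideanSpace ℝ (Fin n) × ℝ → EuclideanSpace ℝ (Fin n)),
        IsBoundedLipschitzDomain Ω →
        volume Ω = (V : ℝ≥0∞) →
        ContinuousOn p (closure (spaceTimeCylinder Ω T)) →
        IsModulusOfContinuityOn ω p (closure (spaceTimeCylinder Ω T)) →
        IsLeast (p '' closure (spaceTimeCylinder Ω T)) pmin →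
        IsGreatest (p '' closure (spaceTimeCylinder Ω T)) pmax →
        MemLinftyL2 Ω T u →
        MemParabolicW Ω T p u g →
        essSupL2Sq Ω T u + varModular (spaceTimeCylinder Ω T) p g ≤ (M : ℝ≥0∞) →
        MemVarLp (spaceTimeCylinder Ω T) (fun z => p z + ε) u ∧
          luxemburgNorm (spaceTimeCylinder Ω T) (fun z => p z + ε) u ≤ (C : ℝ≥0∞) := by
  have hn2 : (2 : ℝ) ≤ n := by exact_mod_cast hn
  have hn0 : (0 : ℝ) < 1 / n := by positivity
  have hn1 : (1 : ℝ) / n ≤ 1 := by rw [div_le_one (by positivity)]; linarith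
  by_cases hω : Tendsto ω (𝓝[>] 0) (𝓝 0)
  swap
  · exact ⟨0, fun Ω p u g _ _ _ h => absurd h.1 hω⟩
  -- The loss `1/n` is half of the gain `2/n`, which leaves `r + 2/n ≥ p + 1/n`; it also keeps `r ≥
  -- 0`, since `p ≥ 1 ≥ 1/n`.
  obtain ⟨L, hL⟩ := exists_uniform_contDiff_exponent (E := EuclideanSpace ℝ (Fin n)) hω pmin pmax
    hn0
  -- The upper bound must be nonnegative before any exponent is given, hence `max pmax 0`.
  obtain ⟨C, hC⟩ := exists_lintegral_rpow_le hn L.2 (le_max_right pmax 0) M V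
  refine ⟨max 1 (C * (T.toNNReal + M)), fun Ω p u g hΩ hV hp hmod hmin hmax hu hW hM => ?_⟩
  have hΩm : MeasurableSet Ω := hΩ.isOpen.measurableSet
  have hpQ : ContinuousOn p (spaceTimeCylinder Ω T) := hp.mono subset_closure
  have hpmin' : ∀ z ∈ spaceTimeCylinder Ω T, pmin ≤ p z := fun z hz =>
    hmin.2 (mem_image_of_mem p (subset_closure hz))
  have hpmax' : ∀ z ∈ spaceTimeCylinder Ω T, p z ≤ pmax := fun z hz =>
    hmax.2 (mem_image_of_mem p (subset_closure hz))
  have hL2 : ∀ᵐ t ∂volume.restrict (Ioo 0 T),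
      eLpNorm (fun x => u (x, t)) 2 (volume.restrict Ω) ^ 2 ≤ M := by
    filter_upwards [ENNReal.ae_le_essSup (μ := volume.restrict (Ioo 0 T))
      (fun t => eLpNorm (fun x => u (x, t)) 2 (volume.restrict Ω) ^ 2)] with t ht
    exact ht.trans (le_self_add.trans hM)
  have hslice : ∀ᵐ t ∂volume.restrict (Ioo 0 T),
      varModular Ω (fun x => p (x, t) + ε) (fun x => u (x, t)) ≤
        C * (1 + varModular Ω (fun x => p (x, t)) (fun x => g (x, t))) := by
    filter_upwards [hW.slice, hL2, ae_restrict_mem measurableSet_Ioo] with t hV' ht2 ht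
    have hmem : ∀ x ∈ Ω, (x, t) ∈ spaceTimeCylinder Ω T := fun x hx => ⟨hx, ht⟩
    obtain ⟨r, hr, hrL, hrp⟩ := hL Ω (fun x => p (x, t)) hΩ.isConnected.nonempty
      (fun x hx y hy => by
        simpa using hmod.2 _ (subset_closure (hmem x hx)) _ (subset_closure (hmem y hy)))
      (fun x hx => hpmin' _ (hmem x hx)) (fun x hx => hpmax' _ (hmem x hx))
    have hp1 : ∀ x ∈ Ω, 1 ≤ p (x, t) := fun x hx => hpmin.le.trans (hpmin' _ (hmem x hx))
    exact hC Ω (fun x => u (x, t)) (fun x => g (x, t)) (fun x => p (x, t)) _ r hΩm hV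
      hV'.memW₀11 ht2 hr hrL
      (fun x hx => by linarith [(hrp x hx).1, hp1 x hx]) (fun x hx => (hrp x hx).2) hp1
      (fun x hx => (hpmax' _ (hmem x hx)).trans (le_max_left _ _))
      (fun x hx => by linarith [hp1 x hx])
      (fun x hx => by
        have : (2 : ℝ) / n = 1 / n + 1 / n := by ring
        linarith [(hrp x hx).1])
  have hmodular : varModular (spaceTimeCylinder Ω T) (fun z => p z + ε) u ≤
      (C * (T.toNNReal + M) : ℝ≥0) := by
    rw [varModular_spaceTimeCylinder (q := fun z => p z + ε) hΩm
      (hpQ.add continuousOn_const) hu.1]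
    refine (lintegral_mono_ae hslice).trans ?_
    rw [lintegral_const_mul' _ _ ENNReal.coe_ne_top, lintegral_add_left measurable_const,
      ← varModular_spaceTimeCylinder hΩm hpQ hW.grad.1, lintegral_const,
      Measure.restrict_apply_univ, Real.volume_Ioo, one_mul, sub_zero]
    push_cast
    gcongr
    · exact le_rfl
    · exact le_add_self.trans hM
  refine ⟨⟨hu.1, hmodular.trans_lt ENNReal.coe_lt_top⟩, ?_⟩
  exact luxemburgNorm_le_max (hΩm.prod measurableSet_Ioo)
    (fun z hz => by linarith [hpmin' z hz]) hmodular
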